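/- **Model.** The machine is a word RAM with $w$-bit words and unit-cost instructions: load a constant into a register; $+,-,\times,\operatorname{div},\bmod$, bitwise and/or/xor and shifts of registers (results modulo $2^w$); load a memory word at an address held in a register; conditional jump. A program is a finite list of instructions. Its memory is a read-only bit string packed into $w$-bit words. **Representation.** Let $S[1..n]$ be a sequence over the alphabet $\{1,\dots,\sigma\}$. Ferragina and Venturini's representation $\mathrm{FV}_\sigma(S)$ is the following bit string. Let $b=\max\bigl(1,\lfloor\tfrac12\log_{\max(\sigma,2)} n\rfloor\bigr)$ and cut $S$ into $m=\lceil n/b\rceil$ blocks of length $b$ (the last one is filled up with the character $1$). Sort the distinct blocks by non-increasing frequency, and assign to the block of rank $r=0,1,2,\dots$ the $r$-th string of the enumeration $\varepsilon,0,1,00,01,10,11,000,\dots$ of all binary strings by length. Let $V$ be the concatenation of the codewords of the $m$ blocks of $S$. Then $\mathrm{FV}_\sigma(S)$ consists of: (i) the starting position in $V$ of every superblock of $\lfloor\lg n\rfloor+1$ consecutive blocks, each in as many bits as the binary notation of $|V|$ has; (ii) the starting position of every block relative to that of its superblock, in $O(\log\log n)$ bits each; (iii) the table that maps each rank to the block of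 that rank, with $\lceil\lg\sigma\rceil$ bits per character; (iv) the string $V$. The tables (i) and (ii) also have the entry for the position $m$, the end of $V$. **Lemma.** There are a program $P$ and a constant $T$ such that the following holds. Let $\Delta,w:\mathbb N\to\mathbb N$ be such that $\Delta(n)\in o\left(\frac{\log n}{(\log\log n)^2}\right)$, $w(n)\in O(\log n)$, and, for some $\varepsilon>0$, $w(n)\ge(1+\varepsilon)\lg n$ for all sufficiently large $n$. Then there is a function $g(n)\in o(n)$ such that for all sufficiently large $n$, every $\sigma\le\Delta(n)$ and every sequence $S[1..n]$ of positive integers with $\max_i S[i]\le\sigma$, there is a bit string $A$ of at most $g(n)$ bits with this property: on the word RAM with $w(n)$-bit words whose memory holds $A$ followed by $\mathrm{FV}_\sigma(S)$, the program $P$, given any $i\in\{0,1,\dots,n\}$, halts after at most $T$ steps with output $S.\mathsf{sum}(i)=S[1]+\dots+S[i]$. -/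

import Mathlib

open Asymptotics Filter

/-! ## Word RAM

A unit-cost random access machine with `w`-bit words.  The stored data structure is a read-only
array of words; the working space of a query consists of registers only.  Every executed
instruction costs one unit of time. -/

namespace WordRAM

/-- Binary operations on words.  Arithmetic is modulo `2 ^ w`, on unsigned words;
`div` and `mod` are integer quotient and remainder. -/
inductive Op where
  | add | sub | mul | div | mod | and | or | xor | shl | shr

/-- The effect of an operation on two `w`-bit words. -/
def Op.eval {w : ℕ} : Op → BitVec w → BitVec w → BitVec w
  | .add, x, y => x + y
  | .sub, x, y => x - y
  | .mul, x, y => x * y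
  | .div, x, y => x / y
  | .mod, x, y => x % y
  | .and, x, y => x &&& y
  | .or, x, y => x ||| y
  | .xor, x, y => x ^^^ y
  | .shl, x, y => x <<< y
  | .shr, x, y => x >>> y

/-- Instructions.  Registers are named by natural numbers; a program, being a finite list,
mentions only finitely many of them.
* `const d k`: put the number `k` (modulo `2 ^ w`) into register `d`;
* `op o d a b`: put the result of `o` on registers `a`, `b` into register `d`;
* `load d a`: put the memory word whose address is in register `a` into register `d`;
* `jumpIfLt a b l`: continue with instruction number `l` if the (unsigned) content of register `a`
  is smaller than that of register `b`. -/
inductive Instr where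
  | const (d k : ℕ)
  | op (o : Op) (d a b : ℕ)
  | load (d a : ℕ)
  | jumpIfLt (a b l : ℕ)

/-- A program is a finite list of instructions; it does not depend on the word length. -/
abbrev Program := List Instr

/-- A configuration: the number of the next instruction, and the contents of the registers. -/
structure Config (w : ℕ) where
  pc : ℕ
  reg : ℕ → BitVec w

/-- The effect of one instruction, with memory `M`. -/
def Instr.exec {w : ℕ} (M : ℕ → BitVec w) (s : Config w) : Instr → Config w
  | .const d k => ⟨s.pc + 1, Function.update s.reg d (BitVec.ofNat w k)⟩
  | .op o d a b => ⟨s.pc + 1, Function.update s.reg d (o.eval (s.reg a) (s.reg b))⟩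
  | .load d a => ⟨s.pc + 1, Function.update s.reg d (M (s.reg a).toNat)⟩
  | .jumpIfLt a b l =>
      ⟨if (s.reg a).toNat < (s.reg b).toNat then l else s.pc + 1, s.reg⟩

/-- One step of program `P`.  The machine has halted when there is no instruction number `pc`;
a halted configuration does not change any more. -/
def step {w : ℕ} (P : Program) (M : ℕ → BitVec w) (s : Config w) : Config w :=
  match P[s.pc]? with
  | some i => i.exec M s
  | none => s

/-- The start configuration on query `q`: `q` is in register `0`, all other registers are `0`. -/
def startConfig (w q : ℕ) : Config w :=
  ⟨0, Function.update (fun _ => 0) 0 (BitVec.ofNat w q)⟩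

/-- A bit string packed into consecutive `w`-bit words: bit number `p` of the string is bit number
`p % w` (counted from the least significant one) of word number `p / w`; the rest is `0`. -/
def pack (w : ℕ) (bits : List Bool) (j : ℕ) : BitVec w :=
  BitVec.ofFnLE (fun t : Fin w => bits.getD (j * w + t) false)

/-- On a machine with word length `w` whose memory holds the bit string `bits`, program `P`,
started on query `q`, halts after at most `T` steps with the number `v` in register `0`. -/
def Answers (P : Program) (w : ℕ) (bits : List Bool) (q v T : ℕ) : Prop :=
  let s := (step P (pack w bits))^[T] (startConfig w q)
  P.length ≤ s.pc ∧ (s.reg 0).toNat = v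

end WordRAM

/-! ## The storage scheme of Ferragina and Venturini

`S` is a sequence over the alphabet `{1, …, σ}`. -/

namespace FV

/-- The number `v` as a field of `len` bits, least significant bit first. -/
def field (len v : ℕ) : List Bool :=
  (List.range len).map v.testBit

/-- The block length `⌊(1/2) log_σ n⌋`, where the base is at least `2` and the result at
least `1`. -/
def blockLen (σ n : ℕ) : ℕ :=
  max 1 (Nat.log (max 2 σ) n / 2)

/-- The number `⌈n / b⌉` of blocks. -/
def numBlocks (σ : ℕ) (S : List ℕ) : ℕ :=
  (S.length + blockLen σ S.length - 1) / blockLen σ S.length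

/-- The `j`-th block of `S` (`j` counts from `0`); the last block is filled up with the
character `1`. -/
def block (σ : ℕ) (S : List ℕ) (j : ℕ) : List ℕ :=
  (List.range (blockLen σ S.length)).map
    (fun t => S.getD (j * blockLen σ S.length + t) 1)

/-- The sequence of the blocks of `S`. -/
def blocks (σ : ℕ) (S : List ℕ) : List (List ℕ) :=
  (List.range (numBlocks σ S)).map (block σ S)

/-- The distinct blocks, sorted by non-increasing frequency. -/
def ranked (σ : ℕ) (S : List ℕ) : List (List ℕ) :=
  (blocks σ S).dedup.mergeSort
    (fun x y => decide ((blocks σ S).count y ≤ (blocks σ S).count x))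

/-- The rank of the `j`-th block in the list of the distinct blocks, starting from `0`. -/
def rank (σ : ℕ) (S : List ℕ) (j : ℕ) : ℕ :=
  (ranked σ S).idxOf (block σ S j)

/-- Number `r` (starting from `0`) in the enumeration `ε, 0, 1, 00, 01, 10, 11, 000, …` of all
binary strings by length: the binary digits of `r + 1` without the leading `1`.  (Numbers are
stored with the least significant bit first.) -/
def codeword (r : ℕ) : List Bool :=
  field (Nat.log 2 (r + 1)) (r + 1 - 2 ^ Nat.log 2 (r + 1))

/-- The concatenation of the codewords of the first `j` blocks. -/
def codePrefix (σ : ℕ) (S : List ℕ) (j : ℕ) : List Bool :=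
  (List.range j).flatMap (fun i => codeword (rank σ S i))

/-- The concatenation `V` of the codewords of all blocks. -/
def code (σ : ℕ) (S : List ℕ) : List Bool :=
  codePrefix σ S (numBlocks σ S)

/-- The starting position of the codeword of block `j` in `V`
(for `j = numBlocks`: the length of `V`). -/
def startPos (σ : ℕ) (S : List ℕ) (j : ℕ) : ℕ :=
  (codePrefix σ S j).length

/-- The number `Θ(log n)` of consecutive blocks in a superblock. -/
def superLen (n : ℕ) : ℕ :=
  Nat.log 2 n + 1

/-- First level: the starting position in `V` of each superblock, in `O(log n)` bits each. -/
def superTable (σ : ℕ) (S : List ℕ) : List Bool :=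
  (List.range (numBlocks σ S / superLen S.length + 1)).flatMap
    (fun q => field (Nat.size (code σ S).length) (startPos σ S (q * superLen S.length)))

/-- Second level: the starting position of each block relative to its superblock.  No codeword is
longer than `log₂` of the number of distinct blocks, so `O(log log n)` bits each suffice.  As in
the first level there is a last entry for the end of `V`. -/
def blockTable (σ : ℕ) (S : List ℕ) : List Bool :=
  (List.range (numBlocks σ S + 1)).flatMap
    (fun j => field (Nat.size (superLen S.length * Nat.log 2 (ranked σ S).length))
      (startPos σ S j - startPos σ S (j / superLen S.length * superLen S.length)))

/-- The table that maps a rank to the block of that rank, each character `x` of which is written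
as `x - 1` in `⌈log₂ σ⌉` bits. -/
def inverseTable (σ : ℕ) (S : List ℕ) : List Bool :=
  (ranked σ S).flatMap (fun B => B.flatMap (fun x => field (Nat.clog 2 σ) (x - 1)))

/-- The representation of `S`, a sequence over the alphabet `{1, …, σ}`, as a bit string. -/
def representation (σ : ℕ) (S : List ℕ) : List Bool :=
  superTable σ S ++ blockTable σ S ++ inverseTable σ S ++ code σ S

end FV

/-! Write `i = j * b + t` with `t < b`. The required sum is the sum before the superblock of block
`j`, plus the sum from there to block `j`, plus the sum of the first `t` characters of block `j`.
The string `A` keeps the first summand in a full word per superblock, the second in a short record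
per block, and the third in a table indexed by the rank of the block and by `t`. The rank is read
from `V`: a codeword of `y` bits with value `v` belongs to rank `v + 2 ^ y - 1`. The superblock
words and the records also hold the position and length of the codeword, so of the representation
itself only `V` is consulted, and straight-line code suffices (`sumProgram_answers`,
`auxBits_answers`).

For the size of `A`, the growth of `Δ` enters only through `σ ≤ superLen n`. Then the block length
is at least of order `log n / log log n`, so the records, of `O(log log n)` bits each, take `O(n
(log log n)² / log n)` bits in all. A superblock costs `O(log n)` bits and has about `log n` blocks.
There are at most `√n` distinct blocks for large `n`, so the table of partial sums takes `O(√n log²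
n)` bits. All this is `o(n)` (`length_auxBits_le`, `eventually_mul_auxBound_le`).

The lower bound on `w` gives `n log n = o(2 ^ w)`, so that all addresses and sums fit into one word.
-/

open WordRAM

/-! ### Straight-line programs. -/

namespace WordRAM

/-- The value that a non-jump instruction writes into its destination register. -/
def Instr.val {w : ℕ} (M : ℕ → BitVec w) (ρ : ℕ → BitVec w) : Instr → BitVec w
  | .const _ k => BitVec.ofNat w k
  | .op o _ a b => o.eval (ρ a) (ρ b)
  | .load _ a => M (ρ a).toNat
  | .jumpIfLt _ _ _ => 0

/-- The instruction writes register `k + 1` and reads only registers up to `k`. -/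
def Instr.IsFresh (k : ℕ) : Instr → Prop
  | .const d _ => d = k + 1
  | .op _ d a b => d = k + 1 ∧ a ≤ k ∧ b ≤ k
  | .load d a => d = k + 1 ∧ a ≤ k
  | .jumpIfLt _ _ _ => False

instance (k : ℕ) (c : Instr) : Decidable (c.IsFresh k) := by
  cases c <;> unfold Instr.IsFresh <;> infer_instance

theorem Instr.IsFresh.exec_eq {w k : ℕ} {c : Instr} (h : c.IsFresh k) (M : ℕ → BitVec w)
    (s : Config w) : c.exec M s = ⟨s.pc + 1, Function.update s.reg (k + 1) (c.val M s.reg)⟩ := by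
  cases c <;> simp_all [Instr.IsFresh, Instr.exec, Instr.val]

theorem Instr.IsFresh.val_congr {w k : ℕ} {c : Instr} (h : c.IsFresh k) (M : ℕ → BitVec w)
    {ρ ρ' : ℕ → BitVec w} (hρ : ∀ r ≤ k, ρ r = ρ' r) : c.val M ρ = c.val M ρ' := by
  cases c <;> simp_all [Instr.IsFresh, Instr.val]

/-- The registers after the execution of straight-line code in which each instruction writes a
fresh register satisfy the defining equations of all its instructions. -/
theorem run_fresh {w : ℕ} (P : Program) (M : ℕ → BitVec w) (q N : ℕ)
    (hN : ∀ k < N, ∃ c, P[k]? = some c ∧ c.IsFresh k) :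
    ∃ ρ : ℕ → BitVec w, (step P M)^[N] (startConfig w q) = ⟨N, ρ⟩ ∧ ρ 0 = BitVec.ofNat w q ∧
      ∀ k < N, ∀ c, P[k]? = some c → ρ (k + 1) = c.val M ρ := by
  induction N with
  | zero => exact ⟨_, rfl, by simp, by simp⟩
  | succ N ih =>
    obtain ⟨ρ, h1, h2, h3⟩ := ih fun k hk => hN k (by omega)
    obtain ⟨c, hc, hf⟩ := hN N (by omega)
    refine ⟨Function.update ρ (N + 1) (c.val M ρ), ?_, ?_, ?_⟩
    · rw [Function.iterate_succ_apply', h1]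
      simp [step, hc, hf.exec_eq]
    · simpa using h2
    · intro k hk c' hc'
      obtain ⟨c'', hc'', hf'⟩ := hN k hk
      obtain rfl : c'' = c' := by simpa [hc'] using hc''.symm
      rw [hf'.val_congr M (ρ' := ρ) fun r hr => Function.update_of_ne (by omega) _ _]
      rcases Nat.lt_succ_iff_lt_or_eq.mp hk with h | rfl
      · rw [Function.update_of_ne (by omega), h3 k h c'' hc']
      · obtain rfl : c = c'' := by simpa [hc'] using hc.symm
        simp

/-! ### Reading bit fields that cross word boundaries. -/

/-- The `w` bits of memory from bit position `p` on, assembled from two adjacent words. -/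
def window (w : ℕ) (bits : List Bool) (p : ℕ) : BitVec w :=
  (pack w bits (p / w) >>> (p % w)) ||| (pack w bits (p / w + 1) <<< (w - p % w))

theorem getLsbD_pack (w : ℕ) (bits : List Bool) (j k : ℕ) (hk : k < w) :
    (pack w bits j).getLsbD k = bits.getD (j * w + k) false := by
  simp [pack, hk]

/-- The bit comes from the first word if `p % w + k < w`, and from the second otherwise. If `p % w =
0`, the second word is shifted out entirely, so aligned positions need no separate case. -/
theorem getLsbD_window (w : ℕ) (bits : List Bool) (p k : ℕ) (hk : k < w) :
    (window w bits p).getLsbD k = bits.getD (p + k) false := by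
  have hp := Nat.div_add_mod' p w
  have hm := Nat.mod_lt p (show 0 < w by omega)
  rw [window, BitVec.getLsbD_or, BitVec.getLsbD_ushiftRight, BitVec.getLsbD_shiftLeft]
  by_cases h : p % w + k < w
  · rw [getLsbD_pack _ _ _ _ h]
    have : k < w - p % w := by omega
    simp only [this, decide_true, Bool.not_true, Bool.and_false, Bool.false_and, Bool.or_false]
    congr 1; omega
  · rw [BitVec.getLsbD_of_ge _ _ (by omega), getLsbD_pack _ _ _ _ (by omega)]
    have : ¬ k < w - p % w := by omega
    simp only [this, hk, decide_true, decide_false, Bool.not_false, Bool.true_and, Bool.false_or]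
    congr 1
    rw [Nat.add_mul, one_mul]; omega

/-- The bit string `bits` contains the number `v` as a field of `c` bits at position `p`. -/
def HasField (bits : List Bool) (p c v : ℕ) : Prop :=
  ∀ k < c, bits.getD (p + k) false = v.testBit k

/-- Fields start with their least significant bit, so one reduction modulo a power of two removes
whatever follows the field. -/
theorem toNat_window_mod {w c v p : ℕ} {bits : List Bool} (hc : c ≤ w) (hv : v < 2 ^ c)
    (h : HasField bits p c v) : (window w bits p).toNat % 2 ^ c = v := by
  apply Nat.eq_of_testBit_eq
  intro k
  rw [Nat.testBit_mod_two_pow]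
  by_cases hk : k < c
  · simp only [hk, decide_true, Bool.true_and]
    rw [← h k hk, ← getLsbD_window w bits p k (by omega), BitVec.getLsbD]
  · simp only [hk, decide_false, Bool.false_and]
    exact (Nat.testBit_lt_two_pow (hv.trans_le (Nat.pow_le_pow_right (by norm_num) (by omega)))).symm

theorem toNat_pack {w v j : ℕ} {bits : List Bool} (hv : v < 2 ^ w)
    (h : HasField bits (j * w) w v) : (pack w bits j).toNat = v := by
  apply Nat.eq_of_testBit_eq
  intro k
  by_cases hk : k < w
  · rw [← h k hk, ← getLsbD_pack w bits j k hk, BitVec.getLsbD]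
  · rw [Nat.testBit_lt_two_pow (hv.trans_le (Nat.pow_le_pow_right (by norm_num) (by omega)))]
    exact BitVec.getLsbD_of_ge (pack w bits j) k (by omega)

/-! ### The query program and its run. -/

/-- The query program.  Memory words `0, …, 6` hold the word length, the block length, the number
of blocks in a superblock, the number `2 ^ l`, the length `3 * l` of a block record, the address of
the table of partial sums, and the bit position of the block records.  Two words for each superblock
follow. -/
def sumProgram : Program :=
  [.const 1 0, .load 2 1,
   .const 3 1, .load 4 3,
   .const 5 2, .load 6 5,
   .const 7 3, .load 8 7,
   .const 9 4, .load 10 9,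
   .const 11 5, .load 12 11,
   .const 13 6, .load 14 13,
   .const 15 7,
   .op .div 16 0 4,
   .op .mod 17 0 4,
   .op .div 18 16 6,
   .op .add 19 18 18,
   .op .add 20 19 15,
   .load 21 20,
   .op .add 22 20 3,
   .load 23 22,
   .op .mul 24 16 10,
   .op .add 25 24 14,
   .op .div 26 25 2,
   .op .mod 27 25 2,
   .load 28 26,
   .op .add 29 26 3,
   .load 30 29,
   .op .shr 31 28 27,
   .op .sub 32 2 27,
   .op .shl 33 30 32,
   .op .or 34 31 33,
   .op .mod 35 34 8,
   .op .div 36 34 8,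
   .op .mod 37 36 8,
   .op .div 38 36 8,
   .op .mod 39 38 8,
   .op .add 40 21 35,
   .op .div 41 40 2,
   .op .mod 42 40 2,
   .load 43 41,
   .op .add 44 41 3,
   .load 45 44,
   .op .shr 46 43 42,
   .op .sub 47 2 42,
   .op .shl 48 45 47,
   .op .or 49 46 48,
   .op .shl 50 3 37,
   .op .mod 51 49 50,
   .op .add 52 51 50,
   .op .mul 53 52 4,
   .op .add 54 53 17,
   .op .add 55 54 12,
   .load 56 55,
   .op .add 57 23 39,
   .op .add 0 57 56]

theorem isFresh_sumProgram :
    ∀ k < 57, ∃ c, sumProgram[k]? = some c ∧ c.IsFresh k := by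
  intro k hk
  have h : ∀ k : Fin 57, (sumProgram[k.val]'(k.isLt.trans (by decide))).IsFresh k := by decide
  have hk' : k < sumProgram.length := hk.trans (by decide)
  exact ⟨sumProgram[k], List.getElem?_eq_getElem hk', h ⟨k, hk⟩⟩

/-- The instructions that assemble a window from two words compute it. -/
theorem toNat_window_instrs {w : ℕ} {bits : List Bool} {p : ℕ} {a e : BitVec w}
    {one lo off w0 hi w1 u sh v r : BitVec w}
    (hw : 0 < w) (hp : p + 1 < 2 ^ w) (ha : a.toNat = p) (he : e.toNat = w) (h1 : one.toNat = 1)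
    (hlo : lo = a / e) (hoff : off = a % e) (hw0 : w0 = pack w bits lo.toNat) (hhi : hi = lo + one)
    (hw1 : w1 = pack w bits hi.toNat) (hu : u = w0 >>> off) (hsh : sh = e - off)
    (hv : v = w1 <<< sh) (hr : r = u ||| v) : r = window w bits p := by
  have hlo' : lo.toNat = p / w := by rw [hlo, BitVec.toNat_udiv, ha, he]
  have hoff' : off.toNat = p % w := by rw [hoff, BitVec.toNat_umod, ha, he]
  have hdiv : p / w ≤ p := Nat.div_le_self _ _
  have hhi' : hi.toNat = p / w + 1 := by
    rw [hhi, BitVec.toNat_add, hlo', h1, Nat.mod_eq_of_lt (by omega)]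
  have hm := Nat.mod_lt p hw
  have hsh' : sh.toNat = w - p % w := by
    rw [hsh, BitVec.toNat_sub_of_le, hoff', he]
    rw [BitVec.le_def, hoff', he]; exact hm.le
  rw [hr, hv, hu, hw0, hw1, hlo', hhi', window, BitVec.ushiftRight_eq', BitVec.shiftLeft_eq',
    hoff', hsh']

theorem three_digits_lt {K x y z : ℕ} (hx : x < K) (hy : y < K) (hz : z < K) :
    x + K * (y + K * z) < K * (K * K) := by
  have hyz : y + K * z + 1 ≤ K * K := by nlinarith
  nlinarith

/-- A block record is a three-digit number in base `K`. The window `W` may contain foreign bits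
above it, but the three extractions depend only on `W` modulo `K ^ 3`. -/
theorem three_digits_of_mod {K x y z W : ℕ} (hx : x < K) (hy : y < K)
    (h : W % (K * (K * K)) = x + K * (y + K * z)) :
    W % K = x ∧ W / K % K = y ∧ W / K / K % K = z := by
  have hK : 0 < K := by omega
  have hz : W / K % (K * K) = y + K * z := by
    rw [← Nat.mod_mul_right_div_self, h, Nat.add_mul_div_left _ _ hK, Nat.div_eq_of_lt hx,
      zero_add]
  refine ⟨?_, ?_, ?_⟩
  · rw [← Nat.mod_mul_right_mod W K (K * K), h, Nat.add_mul_mod_self_left, Nat.mod_eq_of_lt hx]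
  · rw [← Nat.mod_mul_right_mod _ K K, hz, Nat.add_mul_mod_self_left, Nat.mod_eq_of_lt hy]
  · rw [← Nat.mod_mul_right_div_self, hz, Nat.add_mul_div_left _ _ hK, Nat.div_eq_of_lt hy,
      zero_add]

-- The data structure is abstracted to the few memory contents that one query reads; the hypotheses
-- from `bi` on exclude overflow. Each register is written once before the last instruction, so the
-- values can be computed one register after the other.
set_option maxHeartbeats 2000000 in
theorem sumProgram_answers {w b L l addr base pos sum x y z v u i : ℕ} {bits : List Bool}
    (hw : 3 * l ≤ w) (hl : 3 ≤ l)
    (h0 : (pack w bits 0).toNat = w) (h1 : (pack w bits 1).toNat = b)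
    (h2 : (pack w bits 2).toNat = L) (h3 : (pack w bits 3).toNat = 2 ^ l)
    (h4 : (pack w bits 4).toNat = 3 * l) (h5 : (pack w bits 5).toNat = addr)
    (h6 : (pack w bits 6).toNat = base)
    (hpos : (pack w bits (7 + 2 * (i / b / L))).toNat = pos)
    (hsum : (pack w bits (8 + 2 * (i / b / L))).toNat = sum)
    (hrec : HasField bits (base + 3 * l * (i / b)) (3 * l) (x + 2 ^ l * (y + 2 ^ l * z)))
    (hx : x < 2 ^ l) (hy : y < 2 ^ l) (hz : z < 2 ^ l)
    (hcode : HasField bits (pos + x) y v) (hv : v < 2 ^ y) (hyw : y < w)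
    (hu : (pack w bits (addr + ((v + 2 ^ y) * b + i % b))).toNat = u)
    (bi : i < 2 ^ w) (bq : 8 + 2 * (i / b / L) < 2 ^ w)
    (bbase : base + 3 * l * (i / b) + 1 < 2 ^ w) (bpos : pos + x + 1 < 2 ^ w)
    (baddr : addr + ((v + 2 ^ y) * b + i % b) < 2 ^ w) (bout : sum + z + u < 2 ^ w) :
    Answers sumProgram w bits i (sum + z + u) 58 := by
  obtain ⟨ρ, hrun, hρ0, hρ⟩ := run_fresh sumProgram (pack w bits) i 57 isFresh_sumProgram
  -- The last instruction overwrites register `0` and is therefore not fresh; it is executed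
  -- separately.
  have hfin : (step sumProgram (pack w bits))^[58] (startConfig w i)
      = ⟨58, Function.update ρ 0 (ρ 57 + ρ 56)⟩ := by
    rw [Function.iterate_succ_apply', hrun]; rfl
  suffices hs : (ρ 57 + ρ 56).toNat = sum + z + u by
    rw [Answers, hfin]
    exact ⟨le_of_eq rfl, by simpa using hs⟩
  have hww : w < 2 ^ w := Nat.lt_two_pow_self
  -- Since `9 ≤ 3 * l ≤ w`, the constants of the program are not truncated.
  have h256 : 2 ^ 9 ≤ 2 ^ w := Nat.pow_le_pow_right (by norm_num) (by omega)
  have hlw : 2 ^ l ≤ 2 ^ w := Nat.pow_le_pow_right (by norm_num) (by omega)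
  have r0 : (ρ 0).toNat = i := by rw [hρ0, BitVec.toNat_ofNat, Nat.mod_eq_of_lt bi]
  have hconst : ∀ c, c < 2 ^ 9 → (BitVec.ofNat w c).toNat = c := fun c hc => by
    rw [BitVec.toNat_ofNat, Nat.mod_eq_of_lt (by omega)]
  have r1 : (ρ 1).toNat = 0 := by rw [hρ 0 (by norm_num) _ rfl]; exact hconst 0 (by norm_num)
  have r3 : (ρ 3).toNat = 1 := by rw [hρ 2 (by norm_num) _ rfl]; exact hconst 1 (by norm_num)
  have r5 : (ρ 5).toNat = 2 := by rw [hρ 4 (by norm_num) _ rfl]; exact hconst 2 (by norm_num)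
  have r7 : (ρ 7).toNat = 3 := by rw [hρ 6 (by norm_num) _ rfl]; exact hconst 3 (by norm_num)
  have r9 : (ρ 9).toNat = 4 := by rw [hρ 8 (by norm_num) _ rfl]; exact hconst 4 (by norm_num)
  have r11 : (ρ 11).toNat = 5 := by rw [hρ 10 (by norm_num) _ rfl]; exact hconst 5 (by norm_num)
  have r13 : (ρ 13).toNat = 6 := by rw [hρ 12 (by norm_num) _ rfl]; exact hconst 6 (by norm_num)
  have r15 : (ρ 15).toNat = 7 := by rw [hρ 14 (by norm_num) _ rfl]; exact hconst 7 (by norm_num)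
  have r2 : (ρ 2).toNat = w := by
    rw [hρ 1 (by norm_num) _ rfl]; simp only [Instr.val]; rw [r1, h0]
  have r4 : (ρ 4).toNat = b := by
    rw [hρ 3 (by norm_num) _ rfl]; simp only [Instr.val]; rw [r3, h1]
  have r6 : (ρ 6).toNat = L := by
    rw [hρ 5 (by norm_num) _ rfl]; simp only [Instr.val]; rw [r5, h2]
  have r8 : (ρ 8).toNat = 2 ^ l := by
    rw [hρ 7 (by norm_num) _ rfl]; simp only [Instr.val]; rw [r7, h3]
  have r10 : (ρ 10).toNat = 3 * l := by
    rw [hρ 9 (by norm_num) _ rfl]; simp only [Instr.val]; rw [r9, h4]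
  have r12 : (ρ 12).toNat = addr := by
    rw [hρ 11 (by norm_num) _ rfl]; simp only [Instr.val]; rw [r11, h5]
  have r14 : (ρ 14).toNat = base := by
    rw [hρ 13 (by norm_num) _ rfl]; simp only [Instr.val]; rw [r13, h6]
  have r16 : (ρ 16).toNat = i / b := by
    rw [hρ 15 (by norm_num) _ rfl]; simp only [Instr.val, Op.eval]
    rw [BitVec.toNat_udiv, r0, r4]
  have r17 : (ρ 17).toNat = i % b := by
    rw [hρ 16 (by norm_num) _ rfl]; simp only [Instr.val, Op.eval]
    rw [BitVec.toNat_umod, r0, r4]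
  have r18 : (ρ 18).toNat = i / b / L := by
    rw [hρ 17 (by norm_num) _ rfl]; simp only [Instr.val, Op.eval]
    rw [BitVec.toNat_udiv, r16, r6]
  have r19 : (ρ 19).toNat = 2 * (i / b / L) := by
    rw [hρ 18 (by norm_num) _ rfl]; simp only [Instr.val, Op.eval]
    rw [BitVec.toNat_add, r18, Nat.mod_eq_of_lt (by omega)]; omega
  have r20 : (ρ 20).toNat = 7 + 2 * (i / b / L) := by
    rw [hρ 19 (by norm_num) _ rfl]; simp only [Instr.val, Op.eval]
    rw [BitVec.toNat_add, r19, r15, Nat.mod_eq_of_lt (by omega)]; omega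
  have r21 : (ρ 21).toNat = pos := by
    rw [hρ 20 (by norm_num) _ rfl]; simp only [Instr.val]; rw [r20, hpos]
  have r22 : (ρ 22).toNat = 8 + 2 * (i / b / L) := by
    rw [hρ 21 (by norm_num) _ rfl]; simp only [Instr.val, Op.eval]
    rw [BitVec.toNat_add, r20, r3, Nat.mod_eq_of_lt (by omega)]; omega
  have r23 : (ρ 23).toNat = sum := by
    rw [hρ 22 (by norm_num) _ rfl]; simp only [Instr.val]; rw [r22, hsum]
  have r24 : (ρ 24).toNat = 3 * l * (i / b) := by
    rw [hρ 23 (by norm_num) _ rfl]; simp only [Instr.val, Op.eval]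
    rw [BitVec.toNat_mul, r16, r10, mul_comm, Nat.mod_eq_of_lt (by omega)]
  have r25 : (ρ 25).toNat = base + 3 * l * (i / b) := by
    rw [hρ 24 (by norm_num) _ rfl]; simp only [Instr.val, Op.eval]
    rw [BitVec.toNat_add, r24, r14, add_comm, Nat.mod_eq_of_lt (by omega)]
  have r34 : ρ 34 = window w bits (base + 3 * l * (i / b)) :=
    toNat_window_instrs (by omega) bbase r25 r2 r3 (hρ 25 (by norm_num) _ rfl)
      (hρ 26 (by norm_num) _ rfl) (hρ 27 (by norm_num) _ rfl) (hρ 28 (by norm_num) _ rfl)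
      (hρ 29 (by norm_num) _ rfl) (hρ 30 (by norm_num) _ rfl) (hρ 31 (by norm_num) _ rfl)
      (hρ 32 (by norm_num) _ rfl) (hρ 33 (by norm_num) _ rfl)
  have hrlt : x + 2 ^ l * (y + 2 ^ l * z) < 2 ^ (3 * l) := by
    rw [show 2 ^ (3 * l) = 2 ^ l * (2 ^ l * 2 ^ l) by ring]
    exact three_digits_lt hx hy hz
  have hwin := toNat_window_mod hw hrlt hrec
  generalize hW : (window w bits (base + 3 * l * (i / b))).toNat = W at hwin
  rw [show 2 ^ (3 * l) = 2 ^ l * (2 ^ l * 2 ^ l) by ring] at hwin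
  obtain ⟨dx, dy, dz⟩ := three_digits_of_mod hx hy hwin
  have r35 : (ρ 35).toNat = x := by
    rw [hρ 34 (by norm_num) _ rfl]; simp only [Instr.val, Op.eval]
    rw [BitVec.toNat_umod, r34, hW, r8, dx]
  have r36 : (ρ 36).toNat = W / 2 ^ l := by
    rw [hρ 35 (by norm_num) _ rfl]; simp only [Instr.val, Op.eval]
    rw [BitVec.toNat_udiv, r34, hW, r8]
  have r37 : (ρ 37).toNat = y := by
    rw [hρ 36 (by norm_num) _ rfl]; simp only [Instr.val, Op.eval]
    rw [BitVec.toNat_umod, r36, r8, dy]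
  have r38 : (ρ 38).toNat = W / 2 ^ l / 2 ^ l := by
    rw [hρ 37 (by norm_num) _ rfl]; simp only [Instr.val, Op.eval]
    rw [BitVec.toNat_udiv, r36, r8]
  have r39 : (ρ 39).toNat = z := by
    rw [hρ 38 (by norm_num) _ rfl]; simp only [Instr.val, Op.eval]
    rw [BitVec.toNat_umod, r38, r8, dz]
  have r40 : (ρ 40).toNat = pos + x := by
    rw [hρ 39 (by norm_num) _ rfl]; simp only [Instr.val, Op.eval]
    rw [BitVec.toNat_add, r21, r35, Nat.mod_eq_of_lt (by omega)]
  have r49 : ρ 49 = window w bits (pos + x) :=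
    toNat_window_instrs (by omega) bpos r40 r2 r3 (hρ 40 (by norm_num) _ rfl)
      (hρ 41 (by norm_num) _ rfl) (hρ 42 (by norm_num) _ rfl) (hρ 43 (by norm_num) _ rfl)
      (hρ 44 (by norm_num) _ rfl) (hρ 45 (by norm_num) _ rfl) (hρ 46 (by norm_num) _ rfl)
      (hρ 47 (by norm_num) _ rfl) (hρ 48 (by norm_num) _ rfl)
  -- Without `y < w` the shift `1 <<< y` would give `0` instead of `2 ^ y`.
  have hyw' : 2 ^ y < 2 ^ w := Nat.pow_lt_pow_right (by norm_num) hyw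
  have r50 : (ρ 50).toNat = 2 ^ y := by
    rw [hρ 49 (by norm_num) _ rfl]; simp only [Instr.val, Op.eval]
    rw [BitVec.shiftLeft_eq', BitVec.toNat_shiftLeft, r3, r37, Nat.shiftLeft_eq, one_mul,
      Nat.mod_eq_of_lt hyw']
  have r51 : (ρ 51).toNat = v := by
    rw [hρ 50 (by norm_num) _ rfl]; simp only [Instr.val, Op.eval]
    rw [BitVec.toNat_umod, r49, r50, toNat_window_mod hyw.le hv hcode]
  have hvy : v + 2 ^ y < 2 ^ w := by
    have : 2 ^ (y + 1) ≤ 2 ^ w := Nat.pow_le_pow_right (by norm_num) hyw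
    rw [pow_succ] at this; omega
  have r52 : (ρ 52).toNat = v + 2 ^ y := by
    rw [hρ 51 (by norm_num) _ rfl]; simp only [Instr.val, Op.eval]
    rw [BitVec.toNat_add, r51, r50, Nat.mod_eq_of_lt hvy]
  have r53 : (ρ 53).toNat = (v + 2 ^ y) * b := by
    rw [hρ 52 (by norm_num) _ rfl]; simp only [Instr.val, Op.eval]
    rw [BitVec.toNat_mul, r52, r4, Nat.mod_eq_of_lt (by omega)]
  have r54 : (ρ 54).toNat = (v + 2 ^ y) * b + i % b := by
    rw [hρ 53 (by norm_num) _ rfl]; simp only [Instr.val, Op.eval]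
    rw [BitVec.toNat_add, r53, r17, Nat.mod_eq_of_lt (by omega)]
  have r55 : (ρ 55).toNat = addr + ((v + 2 ^ y) * b + i % b) := by
    rw [hρ 54 (by norm_num) _ rfl]; simp only [Instr.val, Op.eval]
    rw [BitVec.toNat_add, r54, r12, add_comm, Nat.mod_eq_of_lt (by omega)]
  have r56 : (ρ 56).toNat = u := by
    rw [hρ 55 (by norm_num) _ rfl]; simp only [Instr.val]; rw [r55, hu]
  have r57 : (ρ 57).toNat = sum + z := by
    rw [hρ 56 (by norm_num) _ rfl]; simp only [Instr.val, Op.eval]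
    rw [BitVec.toNat_add, r23, r39, Nat.mod_eq_of_lt (by omega)]
  rw [BitVec.toNat_add, r57, r56, Nat.mod_eq_of_lt bout]

end WordRAM

/-! ### Fields within concatenations. -/

namespace FV

@[simp]
theorem length_field (len v : ℕ) : (field len v).length = len := by simp [field]

theorem getD_field {len v k : ℕ} (hk : k < len) : (field len v).getD k false = v.testBit k := by
  simp [field, List.getD_eq_getElem?_getD, hk]

theorem length_flatMap_field (c N : ℕ) (f : ℕ → ℕ) :
    ((List.range N).flatMap fun j => field c (f j)).length = N * c := by
  simp [List.length_flatMap]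

theorem hasField_append_field (pre post : List Bool) (c v : ℕ) :
    HasField (pre ++ field c v ++ post) pre.length c v := by
  intro k hk
  rw [List.append_assoc, List.getD_append_right _ _ _ _ (by omega), Nat.add_sub_cancel_left,
    List.getD_append _ _ _ _ (by simpa using hk), getD_field hk]

theorem flatMap_range_split {α : Type*} (f : ℕ → List α) {N j : ℕ} (hj : j < N) :
    ∃ post, (List.range N).flatMap f = (List.range j).flatMap f ++ f j ++ post := by
  obtain ⟨r, rfl⟩ : ∃ r, N = (j + 1) + r := ⟨N - (j + 1), by omega⟩
  refine ⟨((List.range r).map (j + 1 + ·)).flatMap f, ?_⟩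
  rw [List.range_add, List.flatMap_append, List.range_succ, List.flatMap_append]
  simp

theorem hasField_flatMap (pre post : List Bool) {c N j : ℕ} (f : ℕ → ℕ) (hj : j < N) :
    HasField (pre ++ ((List.range N).flatMap fun j => field c (f j)) ++ post)
      (pre.length + j * c) c (f j) := by
  obtain ⟨post', h⟩ := flatMap_range_split (fun j => field c (f j)) hj
  rw [h]
  have := hasField_append_field
    (pre ++ (List.range j).flatMap fun j => field c (f j)) (post' ++ post) c (f j)
  rw [List.length_append, length_flatMap_field] at this
  simpa [List.append_assoc] using this

theorem length_codeword (r : ℕ) : (codeword r).length = Nat.log 2 (r + 1) := by simp [codeword]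

/-! ### Blocks, ranks, codeword positions and prefix sums. -/

section blocks

variable (σ : ℕ) (S : List ℕ)

theorem blockLen_pos (σ n : ℕ) : 0 < blockLen σ n := by simp [blockLen]

theorem length_le_numBlocks_mul : S.length ≤ numBlocks σ S * blockLen σ S.length := by
  have hb := blockLen_pos σ S.length
  have h := Nat.div_add_mod' (S.length + blockLen σ S.length - 1) (blockLen σ S.length)
  have h2 := Nat.mod_lt (S.length + blockLen σ S.length - 1) hb
  rw [numBlocks]; omega

theorem numBlocks_mul_lt : numBlocks σ S * blockLen σ S.length < S.length + blockLen σ S.length := by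
  have hb := blockLen_pos σ S.length
  have h := Nat.div_mul_le_self (S.length + blockLen σ S.length - 1) (blockLen σ S.length)
  rw [numBlocks]; omega

theorem numBlocks_le : numBlocks σ S ≤ S.length := by
  have hb := blockLen_pos σ S.length
  have h := numBlocks_mul_lt σ S
  by_contra! hc
  have := Nat.mul_le_mul_right (blockLen σ S.length) hc
  rw [Nat.succ_mul] at this
  have h1 : S.length ≤ S.length * blockLen σ S.length := Nat.le_mul_of_pos_right _ hb
  omega

theorem numBlocks_pos (hS : 0 < S.length) : 0 < numBlocks σ S := by
  have h := length_le_numBlocks_mul σ S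
  by_contra! hc
  simp [Nat.le_zero.mp hc] at h
  simp [h] at hS

theorem perm_ranked : (ranked σ S).Perm (blocks σ S).dedup := List.mergeSort_perm _ _

theorem length_ranked_le : (ranked σ S).length ≤ numBlocks σ S := by
  rw [(perm_ranked σ S).length_eq]
  exact (List.dedup_sublist _).length_le.trans (by simp [blocks])

theorem block_mem_ranked {j : ℕ} (hj : j < numBlocks σ S) : block σ S j ∈ ranked σ S := by
  rw [(perm_ranked σ S).mem_iff, List.mem_dedup, blocks, List.mem_map]
  exact ⟨j, by simpa using hj, rfl⟩

theorem rank_lt {j : ℕ} (hj : j < numBlocks σ S) : rank σ S j < (ranked σ S).length :=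
  List.idxOf_lt_length_iff.mpr (block_mem_ranked σ S hj)

theorem getD_rank {j : ℕ} (hj : j < numBlocks σ S) :
    (ranked σ S).getD (rank σ S j) [] = block σ S j := by
  rw [List.getD_eq_getElem _ _ (rank_lt σ S hj)]
  exact List.getElem_idxOf (rank_lt σ S hj)

theorem startPos_succ (j : ℕ) :
    startPos σ S (j + 1) = startPos σ S j + Nat.log 2 (rank σ S j + 1) := by
  simp [startPos, codePrefix, List.range_succ, length_codeword]

theorem startPos_mono : Monotone (startPos σ S) :=
  monotone_nat_of_le_succ fun j => by rw [startPos_succ]; omega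

theorem log_rank_le {j : ℕ} (hj : j < numBlocks σ S) :
    Nat.log 2 (rank σ S j + 1) ≤ Nat.log 2 S.length :=
  Nat.log_mono_right
    ((rank_lt σ S hj).trans_le ((length_ranked_le σ S).trans (numBlocks_le σ S)))

theorem startPos_add_le (j r : ℕ) (h : j + r ≤ numBlocks σ S) :
    startPos σ S (j + r) ≤ startPos σ S j + r * Nat.log 2 S.length := by
  induction r with
  | zero => simp
  | succ r ih =>
    have h1 := ih (by omega)
    have h2 := log_rank_le σ S (j := j + r) (by omega)
    rw [← add_assoc, startPos_succ, Nat.succ_mul]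
    omega

/-- The sum of the first `i` characters of the sequence continued by the character `1`. -/
def prefixSum (S : List ℕ) (i : ℕ) : ℕ := ∑ k ∈ Finset.range i, S.getD k 1

theorem prefixSum_add (i t : ℕ) :
    prefixSum S (i + t) = prefixSum S i + ∑ k ∈ Finset.range t, S.getD (i + k) 1 :=
  Finset.sum_range_add _ _ _

theorem prefixSum_mono : Monotone (prefixSum S) := fun a c h => by
  obtain ⟨t, rfl⟩ := Nat.exists_eq_add_of_le h
  rw [prefixSum_add]; omega

theorem take_sum_eq_prefixSum {i : ℕ} (hi : i ≤ S.length) : (S.take i).sum = prefixSum S i := by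
  induction i with
  | zero => simp [prefixSum]
  | succ i ih =>
    have h : i < S.length := hi
    rw [List.take_succ_eq_append_getElem h, List.sum_append, ih h.le, prefixSum, prefixSum,
      Finset.sum_range_succ, List.getD_eq_getElem _ _ h]
    simp

/-- The default `1` is also the character that fills up the last block, so that block is no
exception. -/
theorem take_block_sum {j t : ℕ} (ht : t ≤ blockLen σ S.length) :
    ((block σ S j).take t).sum
      = ∑ k ∈ Finset.range t, S.getD (j * blockLen σ S.length + k) 1 := by
  rw [block, ← List.map_take, List.take_range, min_eq_left ht, Finset.sum_range]
  rw [← List.sum_ofFn, List.ofFn_eq_map, ← List.map_coe_finRange_eq_range, List.map_map]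
  rfl

variable {σ S}

/-- The default `1` lies in the alphabet because a nonempty `S` forces `1 ≤ σ`. -/
theorem getD_le (hS : ∀ x ∈ S, 1 ≤ x ∧ x ≤ σ) (h0 : 0 < S.length) (k : ℕ) :
    1 ≤ S.getD k 1 ∧ S.getD k 1 ≤ σ := by
  by_cases h : k < S.length
  · rw [List.getD_eq_getElem _ _ h]
    exact hS _ (List.getElem_mem h)
  · rw [List.getD_eq_default _ _ (by omega)]
    have := hS _ (List.getElem_mem h0)
    omega

theorem prefixSum_add_le (hS : ∀ x ∈ S, 1 ≤ x ∧ x ≤ σ) (h0 : 0 < S.length) (i t : ℕ) :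
    prefixSum S (i + t) ≤ prefixSum S i + t * σ := by
  rw [prefixSum_add]
  have := Finset.sum_le_card_nsmul (Finset.range t) (fun k => S.getD (i + k) 1) σ
    fun k _ => (getD_le hS h0 _).2
  simpa using this

end blocks

/-! ## The additional tables -/

/-- The number of bits of each of the three fields of a block record. -/
def relWidth (n : ℕ) : ℕ := 3 * (Nat.log 2 (superLen n) + 1)

/-- This is the reason for the factor `3` in `relWidth`: relative sums can reach `superLen *
blockLen * σ`, which is at most the cube of `superLen`. -/
theorem superLen_pow_lt (n : ℕ) : superLen n ^ 3 < 2 ^ relWidth n := by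
  rw [relWidth, mul_comm, pow_mul]
  exact Nat.pow_lt_pow_left (Nat.lt_pow_succ_log_self (by norm_num) _) (by norm_num)

section tables

variable (σ : ℕ) (S : List ℕ) (w : ℕ)

/-- The number of superblocks. -/
def superCount : ℕ := numBlocks σ S / superLen S.length + 1

/-- The number of machine words of the word-aligned part. -/
def wordCount : ℕ :=
  7 + (2 * superCount σ S + ((ranked σ S).length + 1) * blockLen σ S.length)

/-- The position of the code string in memory. -/
def codeOffset : ℕ :=
  wordCount σ S * w + (numBlocks σ S + 1) * (3 * relWidth S.length)
    + (superTable σ S ++ blockTable σ S ++ inverseTable σ S).length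

/-- The machine words of the word-aligned part: parameters; for each superblock its position in
memory and the sum of the characters before it; for each rank `r` and each `t` the sum of the first
`t` characters of the block of rank `r - 1`. -/
def auxWord : ℕ → ℕ
  | 0 => w
  | 1 => blockLen σ S.length
  | 2 => superLen S.length
  | 3 => 2 ^ relWidth S.length
  | 4 => 3 * relWidth S.length
  | 5 => 7 + 2 * superCount σ S
  | 6 => wordCount σ S * w
  | k + 7 =>
    if k < 2 * superCount σ S then
      if k % 2 = 0 then codeOffset σ S w + startPos σ S (k / 2 * superLen S.length)
      else prefixSum S (k / 2 * superLen S.length * blockLen σ S.length)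
    else
      (((ranked σ S).getD ((k - 2 * superCount σ S) / blockLen σ S.length - 1) []).take
        ((k - 2 * superCount σ S) % blockLen σ S.length)).sum

/-- The starting position of a block relative to its superblock. -/
def relPos (j : ℕ) : ℕ :=
  startPos σ S j - startPos σ S (j / superLen S.length * superLen S.length)

/-- The length of the codeword of a block; `0` if there is no such block. -/
def codeLen (j : ℕ) : ℕ := if j < numBlocks σ S then Nat.log 2 (rank σ S j + 1) else 0

/-- The sum of the characters between the start of the superblock and the start of the block. -/
def relSum (j : ℕ) : ℕ :=
  prefixSum S (j * blockLen σ S.length)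
    - prefixSum S (j / superLen S.length * superLen S.length * blockLen σ S.length)

/-- The record of a block. -/
def blockRecord (j : ℕ) : ℕ :=
  relPos σ S j + 2 ^ relWidth S.length * (codeLen σ S j + 2 ^ relWidth S.length * relSum σ S j)

/-- The additional bit string that supports prefix sums. -/
def auxBits : List Bool :=
  ((List.range (wordCount σ S)).flatMap fun k => field w (auxWord σ S w k)) ++
    ((List.range (numBlocks σ S + 1)).flatMap fun j =>
      field (3 * relWidth S.length) (blockRecord σ S j))

theorem length_auxBits : (auxBits σ S w).length
    = wordCount σ S * w + (numBlocks σ S + 1) * (3 * relWidth S.length) := by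
  rw [auxBits, List.length_append, length_flatMap_field, length_flatMap_field]

theorem hasField_auxWord {k : ℕ} (hk : k < wordCount σ S) (post : List Bool) :
    HasField (auxBits σ S w ++ post) (k * w) w (auxWord σ S w k) := by
  rw [auxBits, List.append_assoc]
  simpa using hasField_flatMap [] _ (auxWord σ S w) hk

theorem hasField_blockRecord {j : ℕ} (hj : j < numBlocks σ S + 1) (post : List Bool) :
    HasField (auxBits σ S w ++ post) (wordCount σ S * w + 3 * relWidth S.length * j)
      (3 * relWidth S.length) (blockRecord σ S j) := by
  have := hasField_flatMap ((List.range (wordCount σ S)).flatMap fun k => field w (auxWord σ S w k))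
    post (c := 3 * relWidth S.length) (blockRecord σ S) hj
  rwa [length_flatMap_field, mul_comm j] at this

/-- `V` is the last part of the representation and everything before it has a known length, so `A`
can store absolute bit positions in `V`. -/
theorem hasField_codeword {j : ℕ} (hj : j < numBlocks σ S) :
    HasField (auxBits σ S w ++ representation σ S) (codeOffset σ S w + startPos σ S j)
      (codeLen σ S j) (rank σ S j + 1 - 2 ^ codeLen σ S j) := by
  obtain ⟨post, h⟩ := flatMap_range_split (fun i => codeword (rank σ S i)) hj
  have hlen : codeLen σ S j = Nat.log 2 (rank σ S j + 1) := if_pos hj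
  rw [representation, code, codePrefix, h, hlen]
  have := hasField_append_field (auxBits σ S w ++ (superTable σ S ++ blockTable σ S ++
    inverseTable σ S) ++ codePrefix σ S j) post (Nat.log 2 (rank σ S j + 1))
    (rank σ S j + 1 - 2 ^ Nat.log 2 (rank σ S j + 1))
  rw [List.length_append, List.length_append, length_auxBits] at this
  simpa only [List.append_assoc, codePrefix, codeOffset, startPos, codeword] using this

theorem codeOffset_add_length_code : codeOffset σ S w + (code σ S).length
    = (auxBits σ S w ++ representation σ S).length := by
  rw [codeOffset, ← length_auxBits, representation]
  simp only [List.length_append]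
  omega

theorem startPos_le_length_code {j : ℕ} (hj : j ≤ numBlocks σ S) :
    startPos σ S j ≤ (code σ S).length := startPos_mono σ S hj

variable {σ S w}

theorem blockLen_le_superLen (σ n : ℕ) : blockLen σ n ≤ superLen n := by
  have h : Nat.log (max 2 σ) n ≤ Nat.log 2 n := Nat.log_anti_left (by norm_num) (le_max_left _ _)
  rw [blockLen, superLen]; omega

theorem codeLen_lt (j : ℕ) : codeLen σ S j < superLen S.length := by
  rw [codeLen, superLen]
  split_ifs with h
  · exact Nat.lt_succ_of_le (log_rank_le σ S h)
  · omega

/-- Fewer than `superLen` codewords, each shorter than `superLen`, lie between the start of the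
superblock and block `j`. -/
theorem relPos_lt {j : ℕ} (hj : j ≤ numBlocks σ S) : relPos σ S j < 2 ^ relWidth S.length := by
  refine lt_of_le_of_lt ?_ (superLen_pow_lt S.length)
  have hL : 0 < superLen S.length := Nat.succ_pos _
  have hd := Nat.div_add_mod' j (superLen S.length)
  have hm := Nat.mod_lt j hL
  have h := startPos_add_le σ S (j / superLen S.length * superLen S.length) (j % superLen S.length)
    (by omega)
  rw [hd] at h
  have h2 : j % superLen S.length * Nat.log 2 S.length ≤ superLen S.length * superLen S.length :=
    Nat.mul_le_mul hm.le (Nat.le_succ _)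
  have h3 : superLen S.length * superLen S.length ≤ superLen S.length ^ 3 := by
    rw [← pow_two]; exact Nat.pow_le_pow_right hL (by norm_num)
  rw [relPos]; omega

theorem relSum_lt (hS : ∀ x ∈ S, 1 ≤ x ∧ x ≤ σ) (h0 : 0 < S.length)
    (hσ : σ ≤ superLen S.length) (j : ℕ) : relSum σ S j < 2 ^ relWidth S.length := by
  refine lt_of_le_of_lt ?_ (superLen_pow_lt S.length)
  have hL : 0 < superLen S.length := Nat.succ_pos _
  have hd := Nat.div_add_mod' j (superLen S.length)
  have hm := Nat.mod_lt j hL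
  have h := prefixSum_add_le hS h0
    (j / superLen S.length * superLen S.length * blockLen σ S.length)
    (j % superLen S.length * blockLen σ S.length)
  rw [← add_mul, hd] at h
  have h2 : j % superLen S.length * blockLen σ S.length * σ
      ≤ superLen S.length * superLen S.length * superLen S.length :=
    Nat.mul_le_mul (Nat.mul_le_mul hm.le (blockLen_le_superLen _ _)) hσ
  rw [relSum, show superLen S.length ^ 3
    = superLen S.length * superLen S.length * superLen S.length by ring]
  omega

-- This instantiates `sumProgram_answers`. The bound `hlen` on the whole memory controls addresses
-- and bit positions, and `hsum` controls the sums.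
set_option maxHeartbeats 1000000 in
theorem auxBits_answers (hS : ∀ x ∈ S, 1 ≤ x ∧ x ≤ σ) (h0 : 0 < S.length)
    (hσ : σ ≤ superLen S.length) (hw : 3 * relWidth S.length ≤ w)
    (hlen : (auxBits σ S w ++ representation σ S).length + 2 ≤ 2 ^ w)
    (hsum : S.length * superLen S.length < 2 ^ w) {i : ℕ} (hi : i ≤ S.length) :
    Answers sumProgram w (auxBits σ S w ++ representation σ S) i (S.take i).sum 58 := by
  have hb := blockLen_pos σ S.length
  have hL : 0 < superLen S.length := Nat.succ_pos _
  have hl : 3 ≤ relWidth S.length := by rw [relWidth]; omega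
  have hlw : 2 ^ relWidth S.length ≤ 2 ^ w := Nat.pow_le_pow_right (by norm_num) (by omega)
  have hww : w < 2 ^ w := Nat.lt_two_pow_self
  have hL3 := superLen_pow_lt S.length
  have hL1 : superLen S.length ≤ superLen S.length ^ 3 := Nat.le_self_pow (by norm_num) _
  have hbL := blockLen_le_superLen σ S.length
  have hn : S.length < 2 ^ w := (Nat.le_mul_of_pos_right _ hL).trans_lt hsum
  have hLw : superLen S.length ≤ w := Nat.log_lt_of_lt_pow h0.ne' hn
  have hlenA : wordCount σ S * w + (numBlocks σ S + 1) * (3 * relWidth S.length)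
      ≤ codeOffset σ S w := by rw [codeOffset]; omega
  have hcl := codeOffset_add_length_code σ S w
  have hwc : wordCount σ S ≤ wordCount σ S * w := Nat.le_mul_of_pos_right _ (by omega)
  have hwcdef : wordCount σ S
    = 7 + (2 * superCount σ S + ((ranked σ S).length + 1) * blockLen σ S.length) := rfl
  have word : ∀ k < wordCount σ S, auxWord σ S w k < 2 ^ w →
      (pack w (auxBits σ S w ++ representation σ S) k).toNat = auxWord σ S w k :=
    fun k hk h => toNat_pack h (hasField_auxWord σ S w hk _)
  obtain ⟨j, hj⟩ : ∃ j, j = i / blockLen σ S.length := ⟨_, rfl⟩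
  obtain ⟨t, ht⟩ : ∃ t, t = i % blockLen σ S.length := ⟨_, rfl⟩
  have htb : t < blockLen σ S.length := ht ▸ Nat.mod_lt _ hb
  have hjt : j * blockLen σ S.length + t = i := by rw [hj, ht]; exact Nat.div_add_mod' _ _
  have hjm : j ≤ numBlocks σ S := by
    rw [hj]
    exact Nat.div_le_of_le_mul
      ((hi.trans (length_le_numBlocks_mul σ S)).trans_eq (mul_comm _ _))
  have hqs : j / superLen S.length < superCount σ S :=
    Nat.lt_succ_of_le (Nat.div_le_div_right hjm)
  have hqj : j / superLen S.length * superLen S.length ≤ j := Nat.div_mul_le_self _ _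
  have hD : 0 < (ranked σ S).length :=
    (Nat.zero_le _).trans_lt (rank_lt σ S (numBlocks_pos σ S h0))
  have hsplit : prefixSum S i = prefixSum S (j * blockLen σ S.length)
      + ∑ k ∈ Finset.range t, S.getD (j * blockLen σ S.length + k) 1 := by
    rw [← prefixSum_add, hjt]
  have hrel : prefixSum S (j / superLen S.length * superLen S.length * blockLen σ S.length)
      + relSum σ S j = prefixSum S (j * blockLen σ S.length) :=
    Nat.add_sub_cancel' (prefixSum_mono S (Nat.mul_le_mul_right _ hqj))
  have hpos : codeOffset σ S w + startPos σ S (j / superLen S.length * superLen S.length)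
      + relPos σ S j = codeOffset σ S w + startPos σ S j := by
    rw [add_assoc, relPos, Nat.add_sub_cancel' (startPos_mono σ S hqj)]
  have hposle := startPos_le_length_code σ S hjm
  have hfull : prefixSum S i < 2 ^ w := by
    have := prefixSum_add_le hS h0 0 i
    rw [zero_add, show prefixSum S 0 = 0 from rfl, zero_add] at this
    exact (this.trans (Nat.mul_le_mul hi hσ)).trans_lt hsum
  -- the value of the codeword, and the entry of the table of partial sums
  obtain ⟨v, r, hv, hcode, hvr, hr1, hrD, hu⟩ : ∃ v r, v < 2 ^ codeLen σ S j ∧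
      HasField (auxBits σ S w ++ representation σ S) (codeOffset σ S w + startPos σ S j)
        (codeLen σ S j) v ∧ v + 2 ^ codeLen σ S j = r ∧ 1 ≤ r ∧ r ≤ (ranked σ S).length ∧
      (((ranked σ S).getD (r - 1) []).take t).sum
        = ∑ k ∈ Finset.range t, S.getD (j * blockLen σ S.length + k) 1 := by
    by_cases hlt : j < numBlocks σ S
    · have hlog : codeLen σ S j = Nat.log 2 (rank σ S j + 1) := if_pos hlt
      have h1 : 2 ^ codeLen σ S j ≤ rank σ S j + 1 := by
        rw [hlog]; exact Nat.pow_log_le_self 2 (by omega)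
      have h2 : rank σ S j + 1 < 2 ^ (codeLen σ S j + 1) := by
        rw [hlog]; exact Nat.lt_pow_succ_log_self (by norm_num) _
      rw [pow_succ] at h2
      refine ⟨_, rank σ S j + 1, by omega, hasField_codeword σ S w hlt, by omega, by omega,
        rank_lt σ S hlt, ?_⟩
      rw [Nat.add_sub_cancel, getD_rank σ S hlt, take_block_sum σ S htb.le]
    -- Here `i = n` is a multiple of the block length and there is no block `j`. Its record has
    -- codeword length `0`, so the program reads the entry for rank `0` and `t = 0`, which is an
    -- empty sum.
    · have hlog : codeLen σ S j = 0 := if_neg hlt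
      have hj' : j = numBlocks σ S := by omega
      have ht0 : t = 0 := by
        have := length_le_numBlocks_mul σ S
        rw [← hj'] at this; omega
      refine ⟨0, 1, by simp, ?_, by simp [hlog], le_rfl, hD, by simp [ht0]⟩
      rw [hlog]; intro k hk; omega
  have hrb : r * blockLen σ S.length + t < ((ranked σ S).length + 1) * blockLen σ S.length := by
    have := Nat.mul_le_mul_right (blockLen σ S.length) hrD
    rw [Nat.succ_mul]; omega
  have wpos : auxWord σ S w (7 + 2 * (j / superLen S.length)) = codeOffset σ S w
      + startPos σ S (j / superLen S.length * superLen S.length) := by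
    rw [add_comm, auxWord, if_pos (by omega), if_pos (by omega)]
    congr 3; omega
  have wsum : auxWord σ S w (8 + 2 * (j / superLen S.length)) = prefixSum S
      (j / superLen S.length * superLen S.length * blockLen σ S.length) := by
    rw [show 8 + 2 * (j / superLen S.length) = (2 * (j / superLen S.length) + 1) + 7 by ring,
      auxWord, if_pos (by omega), if_neg (by omega)]
    congr 3; omega
  -- Row `r` of the table belongs to rank `r - 1`, so the decoded number `v + 2 ^ y` is the row
  -- index as it stands. Row `0` is never read.
  have wtab : auxWord σ S w (7 + 2 * superCount σ S + (r * blockLen σ S.length + t))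
      = ∑ k ∈ Finset.range t, S.getD (j * blockLen σ S.length + k) 1 := by
    rw [show 7 + 2 * superCount σ S + (r * blockLen σ S.length + t)
      = (2 * superCount σ S + (r * blockLen σ S.length + t)) + 7 by ring,
      auxWord, if_neg (by omega), Nat.add_sub_cancel_left, add_comm (r * _) t,
      Nat.add_mul_div_right _ _ hb, Nat.div_eq_of_lt htb, zero_add, Nat.add_mul_mod_self_right,
      Nat.mod_eq_of_lt htb, hu]
  have key := sumProgram_answers (w := w) (b := blockLen σ S.length) (L := superLen S.length)
    (l := relWidth S.length) (addr := 7 + 2 * superCount σ S) (base := wordCount σ S * w)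
    (pos := codeOffset σ S w + startPos σ S (j / superLen S.length * superLen S.length))
    (sum := prefixSum S (j / superLen S.length * superLen S.length * blockLen σ S.length))
    (x := relPos σ S j) (y := codeLen σ S j) (z := relSum σ S j) (v := v)
    (u := ∑ k ∈ Finset.range t, S.getD (j * blockLen σ S.length + k) 1) (i := i)
    (bits := auxBits σ S w ++ representation σ S)
  simp only [← hj, ← ht, hvr] at key
  rw [hpos] at key
  have hjrec : 3 * relWidth S.length * j ≤ (numBlocks σ S + 1) * (3 * relWidth S.length) := by
    rw [mul_comm]; exact Nat.mul_le_mul_right _ (by omega)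
  rw [take_sum_eq_prefixSum S hi, hsplit, ← hrel]
  refine key hw hl (word 0 (by omega) hww) (word 1 (by omega) ?_) (word 2 (by omega) ?_)
    (word 3 (by omega) ?_) (word 4 (by omega) ?_) (word 5 (by omega) ?_) (word 6 (by omega) ?_)
    ((word _ (by omega) ?_).trans wpos) ((word _ (by omega) ?_).trans wsum)
    (hasField_blockRecord σ S w (by omega) _) (relPos_lt hjm)
    ((codeLen_lt j).trans (by omega)) (relSum_lt hS h0 hσ j) hcode hv
    ((codeLen_lt j).trans_le hLw) ((word _ (by omega) ?_).trans wtab)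
    (by omega) (by omega) (by omega) (by omega) (by omega) (by omega)
  · change blockLen σ S.length < _; omega
  · change superLen S.length < _; omega
  · change 2 ^ relWidth S.length < _
    exact Nat.pow_lt_pow_right (by norm_num) (by omega)
  · change 3 * relWidth S.length < _; omega
  · change 7 + 2 * superCount σ S < _; omega
  · change wordCount σ S * w < _; omega
  · rw [wpos]; omega
  · rw [wsum]; omega
  · rw [wtab]; omega

end tables

end FV

/-! ### Bounds on the lengths of the bit strings. -/

namespace FV

section bounds

variable {σ : ℕ} {S : List ℕ}

theorem length_of_mem_ranked {x : List ℕ} (hx : x ∈ ranked σ S) :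
    x.length = blockLen σ S.length ∧ ∃ j, x = block σ S j := by
  rw [(perm_ranked σ S).mem_iff, List.mem_dedup, blocks, List.mem_map] at hx
  obtain ⟨j, -, rfl⟩ := hx
  exact ⟨by simp [block], j, rfl⟩

/-- There are at most `σ ^ b` distinct blocks of length `b`. -/
theorem length_ranked_le_pow (hS : ∀ x ∈ S, 1 ≤ x ∧ x ≤ σ) (h0 : 0 < S.length) :
    (ranked σ S).length ≤ σ ^ blockLen σ S.length := by
  have hnd : (ranked σ S).Nodup := (perm_ranked σ S).nodup_iff.mpr (List.nodup_dedup _)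
  rw [← List.toFinset_card_of_nodup hnd]
  have hcard : (Fintype.piFinset fun _ : Fin (blockLen σ S.length) => Finset.Icc 1 σ).card
      = σ ^ blockLen σ S.length := by
    simp [Fintype.card_piFinset]
  rw [← hcard]
  -- As all ranked blocks have the same length, a block is determined by its character function.
  refine Finset.card_le_card_of_injOn (fun x t => x.getD t 1) ?_ ?_
  · intro x hx
    obtain ⟨-, j, rfl⟩ := length_of_mem_ranked (List.mem_toFinset.mp hx)
    simp only [Finset.mem_coe, Fintype.mem_piFinset, Finset.mem_Icc]
    intro t
    rw [List.getD_eq_getElem _ _ (by simp [block])]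
    simpa [block] using getD_le hS h0 (j * blockLen σ S.length + t)
  · intro x hx y hy hxy
    obtain ⟨hx, -⟩ := length_of_mem_ranked (List.mem_toFinset.mp hx)
    obtain ⟨hy, -⟩ := length_of_mem_ranked (List.mem_toFinset.mp hy)
    refine List.ext_getElem (hx.trans hy.symm) fun k hk hk' => ?_
    have := congrFun hxy ⟨k, hx ▸ hk⟩
    simpa [List.getD_eq_getElem, hk, hk'] using this

/-- Twice the block length is at most the logarithm of `n` to base `max 2 σ`, except possibly when
the block length is forced up to `1`; `hσ` covers that case. -/
theorem length_ranked_le_sqrt (hS : ∀ x ∈ S, 1 ≤ x ∧ x ≤ σ) (h0 : 0 < S.length)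
    (hσ : max 2 σ ≤ Nat.sqrt S.length) : (ranked σ S).length ≤ Nat.sqrt S.length := by
  refine (length_ranked_le_pow hS h0).trans
    ((Nat.pow_le_pow_left (le_max_right 2 σ) _).trans ?_)
  rw [blockLen]
  rcases le_total (Nat.log (max 2 σ) S.length / 2) 1 with h | h
  · rwa [max_eq_left h, pow_one]
  · rw [max_eq_right h, Nat.le_sqrt, ← pow_add]
    refine le_trans (Nat.pow_le_pow_right (by omega) ?_) (Nat.pow_log_le_self (max 2 σ) h0.ne')
    omega

/-- A lower bound for the block length that does not depend on the alphabet size. -/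
def minBlockLen (n : ℕ) : ℕ := (superLen n - 1) / (2 * (Nat.log 2 (superLen n) + 1))

/-- With `s = Nat.log 2 (superLen n) + 1` we have `max 2 σ ≤ 2 ^ s`, and the logarithm of `n` to
base `2 ^ s` is at least `⌊log₂ n / s⌋`. -/
theorem minBlockLen_le {n : ℕ} (h0 : 0 < n) (hσ : σ ≤ superLen n) :
    minBlockLen n ≤ blockLen σ n := by
  refine le_trans ?_ (le_max_right _ _)
  rw [minBlockLen, mul_comm, ← Nat.div_div_eq_div_mul]
  refine Nat.div_le_div_right ?_
  have hs : superLen n < 2 ^ (Nat.log 2 (superLen n) + 1) :=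
    Nat.lt_pow_succ_log_self (by norm_num) _
  have h2 : 2 ≤ 2 ^ (Nat.log 2 (superLen n) + 1) := Nat.le_self_pow (by omega) 2
  refine le_trans ?_ (Nat.log_anti_left (by omega)
    (show max 2 σ ≤ 2 ^ (Nat.log 2 (superLen n) + 1) by omega))
  refine Nat.le_log_of_pow_le (by omega) ?_
  rw [← pow_mul]
  refine le_trans (Nat.pow_le_pow_right (by norm_num) (Nat.mul_div_le _ _)) ?_
  exact Nat.pow_log_le_self 2 h0.ne'

theorem numBlocks_le_div {β : ℕ} (hβ : 0 < β) (h : β ≤ blockLen σ S.length) :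
    numBlocks σ S ≤ S.length / β + 1 := by
  have h1 := numBlocks_mul_lt σ S
  have h2 : (numBlocks σ S - 1) * β ≤ S.length := by
    refine (Nat.mul_le_mul_left _ h).trans ?_
    rw [Nat.sub_mul]; omega
  have := (Nat.le_div_iff_mul_le hβ).mpr h2
  omega

/-- An upper bound for the number of additional bits. -/
def auxBound (n w : ℕ) : ℕ :=
  (7 + (2 * ((n / minBlockLen n + 1) / superLen n + 1) + (Nat.sqrt n + 1) * superLen n)) * w
    + (n / minBlockLen n + 2) * (3 * relWidth n)

theorem length_auxBits_le (hS : ∀ x ∈ S, 1 ≤ x ∧ x ≤ σ) (h0 : 0 < S.length)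
    (hσ : σ ≤ superLen S.length) (hβ : 0 < minBlockLen S.length)
    (hσ' : max 2 σ ≤ Nat.sqrt S.length) (w : ℕ) :
    (auxBits σ S w).length ≤ auxBound S.length w := by
  have hm := numBlocks_le_div hβ (minBlockLen_le h0 hσ)
  have hD := length_ranked_le_sqrt hS h0 hσ'
  have hb := blockLen_le_superLen σ S.length
  rw [length_auxBits, auxBound, wordCount, superCount]
  have hm2 : numBlocks σ S + 1 ≤ S.length / minBlockLen S.length + 2 := by omega
  gcongr

theorem length_code_le : (code σ S).length ≤ S.length * superLen S.length := by
  have h := startPos_add_le σ S 0 (numBlocks σ S) (by omega)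
  rw [zero_add, show startPos σ S 0 = 0 from rfl, zero_add] at h
  exact h.trans (Nat.mul_le_mul (numBlocks_le σ S) (Nat.le_succ _))

theorem lt_two_pow_superLen (n : ℕ) : n < 2 ^ superLen n :=
  Nat.lt_pow_succ_log_self (by norm_num) n

theorem superLen_le {n : ℕ} (h0 : 0 < n) : superLen n ≤ n := Nat.log_lt_self 2 h0.ne'

theorem size_le_of_le_mul {n x : ℕ} (h : x ≤ n * superLen n) : Nat.size x ≤ 2 * superLen n := by
  rw [Nat.size_le, two_mul, pow_add]
  exact h.trans_lt (Nat.mul_lt_mul'' (lt_two_pow_superLen n) Nat.lt_two_pow_self)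

theorem length_flatMap_const {α β : Type*} {c : ℕ} (l : List α) (f : α → List β)
    (h : ∀ x ∈ l, (f x).length = c) : (l.flatMap f).length = l.length * c := by
  rw [List.length_flatMap, List.map_congr_left h]; simp

/-- A crude bound, sufficient for addressing; the four parts contribute `4`, `4`, `2` and `1`. -/
theorem length_representation_le (h0 : 0 < S.length) (hσ : σ ≤ superLen S.length) :
    (representation σ S).length ≤ 11 * (S.length * superLen S.length) := by
  have hm := numBlocks_le σ S
  have hD := length_ranked_le σ S
  have hcode := length_code_le (σ := σ) (S := S)
  have hL : 0 < superLen S.length := Nat.succ_pos _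
  have hsuper : (superTable σ S).length ≤ 2 * S.length * (2 * superLen S.length) := by
    rw [superTable, length_flatMap_const (c := Nat.size (code σ S).length) _ _ (by simp),
      List.length_range]
    refine Nat.mul_le_mul ?_ (size_le_of_le_mul hcode)
    have := Nat.div_le_self (numBlocks σ S) (superLen S.length)
    omega
  have hblock : (blockTable σ S).length ≤ 2 * S.length * (2 * superLen S.length) := by
    rw [blockTable, length_flatMap_const
      (c := Nat.size (superLen S.length * Nat.log 2 (ranked σ S).length)) _ _ (by simp),
      List.length_range]
    refine Nat.mul_le_mul (by omega) (size_le_of_le_mul ?_)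
    rw [mul_comm]
    exact Nat.mul_le_mul_right _ ((Nat.log_le_self _ _).trans (hD.trans hm))
  have hinv : (inverseTable σ S).length ≤ 2 * S.length * superLen S.length := by
    rw [inverseTable, length_flatMap_const (c := blockLen σ S.length * Nat.clog 2 σ) _ _ ?_,
      ← mul_assoc]
    · refine Nat.mul_le_mul ?_ ?_
      · have h1 := numBlocks_mul_lt σ S
        have h2 := Nat.mul_le_mul_right (blockLen σ S.length) hD
        have h3 := blockLen_le_superLen σ S.length
        have h4 := superLen_le h0
        omega
      · exact (Nat.clog_le_of_le_pow Nat.lt_two_pow_self.le).trans hσ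
    · intro x hx
      rw [length_flatMap_const (c := Nat.clog 2 σ) _ _ (by simp), (length_of_mem_ranked hx).1]
  have e1 : 2 * S.length * (2 * superLen S.length) = 4 * (S.length * superLen S.length) := by ring
  have e2 : 2 * S.length * superLen S.length = 2 * (S.length * superLen S.length) := by ring
  rw [representation]
  simp only [List.length_append]
  omega

end bounds

/-! ## Asymptotics -/

/-- Exponentials beat polynomials in `y = log₂ x`. For `x = superLen n` this compares powers of `log
log n` with `log n`. -/
theorem eventually_mul_log_pow_le (c k : ℕ) : ∀ᶠ x : ℕ in atTop, c * (Nat.log 2 x + 1) ^ k ≤ x := by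
  have hlog : Tendsto (Nat.log 2) atTop atTop := tendsto_atTop.mpr fun y => by
    filter_upwards [eventually_ge_atTop (2 ^ y)] with x hx
    exact Nat.le_log_of_pow_le (by norm_num) hx
  have h := (tendsto_pow_const_div_const_pow_of_one_lt k (r := (2 : ℝ)) (by norm_num)).comp
    (tendsto_add_atTop_nat 1)
  have hev : ∀ᶠ y : ℕ in atTop, c * (y + 1) ^ k ≤ 2 ^ y := by
    -- The factor `2` in the threshold compensates for the denominator `2 ^ (y + 1)`.
    filter_upwards [h.eventually (gt_mem_nhds (show (0 : ℝ) < 1 / (2 * (c + 1)) by positivity))]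
      with y hy
    simp only [Function.comp] at hy
    rw [div_lt_div_iff₀ (by positivity) (by positivity), one_mul, pow_succ] at hy
    have hpos : (0 : ℝ) ≤ ((y + 1 : ℕ) : ℝ) ^ k := by positivity
    have : (c : ℝ) * ((y + 1 : ℕ) : ℝ) ^ k ≤ 2 ^ y := by nlinarith
    exact_mod_cast this
  filter_upwards [hlog.eventually hev, eventually_gt_atTop 0] with x hx h0
  exact hx.trans (Nat.pow_log_le_self 2 h0.ne')

theorem eventually_mul_superLen_pow_le (c k : ℕ) : ∀ᶠ n : ℕ in atTop, c * superLen n ^ k ≤ n :=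
  eventually_mul_log_pow_le c k

theorem tendsto_superLen : Tendsto superLen atTop atTop := tendsto_atTop.mpr fun y => by
  filter_upwards [eventually_ge_atTop (2 ^ y)] with x hx
  exact (Nat.le_log_of_pow_le (by norm_num) hx).trans (Nat.le_succ _)

theorem eventually_mul_superLen_pow_le_sqrt (c k : ℕ) :
    ∀ᶠ n : ℕ in atTop, c * superLen n ^ k ≤ Nat.sqrt n := by
  filter_upwards [eventually_mul_superLen_pow_le (c * c) (k + k)] with n hn
  rw [Nat.le_sqrt]
  calc c * superLen n ^ k * (c * superLen n ^ k) = c * c * superLen n ^ (k + k) := by ring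
    _ ≤ n := hn

theorem eventually_mul_le_minBlockLen (c : ℕ) :
    ∀ᶠ n : ℕ in atTop, c * (Nat.log 2 (superLen n) + 1) ≤ minBlockLen n := by
  -- The summand `1` in `2 * c + 1` pays for the `- 1` in the numerator of `minBlockLen`.
  filter_upwards [tendsto_superLen.eventually (eventually_mul_log_pow_le (2 * c + 1) 2)] with n hn
  rw [minBlockLen, Nat.le_div_iff_mul_le (by omega)]
  have : 1 ≤ (Nat.log 2 (superLen n) + 1) ^ 2 := Nat.one_le_pow _ _ (by omega)
  have e : c * (Nat.log 2 (superLen n) + 1) * (2 * (Nat.log 2 (superLen n) + 1)) + 1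
      ≤ superLen n := by nlinarith
  omega

/-- With `L = superLen n`, `s = log₂ L + 1` and `d = n / minBlockLen n`, the bound is a combination
of `L`, `d * s` and `L ^ 2 * √n`. The superblock words are absorbed by `d * s` and `L`, because the
number of superblocks times `L` is `O(d + L)`. -/
theorem eventually_mul_auxBound_le {w : ℕ → ℕ} {C : ℕ}
    (hw : ∀ᶠ n in atTop, w n ≤ C * superLen n) (c : ℕ) :
    ∀ᶠ n : ℕ in atTop, c * auxBound n (w n) ≤ n := by
  filter_upwards [hw, eventually_mul_superLen_pow_le (3 * (c * (11 * C + 18))) 1,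
    eventually_mul_superLen_pow_le_sqrt (6 * (c * C)) 2,
    eventually_mul_le_minBlockLen (3 * (c * (2 * C + 9))),
    eventually_ge_atTop 1] with n hw h1 h2 h3 hn
  rw [auxBound, relWidth]
  have hL : 0 < superLen n := Nat.succ_pos _
  have hs : Nat.log 2 (superLen n) + 1 ≤ superLen n := Nat.log_lt_self 2 hL.ne'
  have hs1 : 1 ≤ Nat.log 2 (superLen n) + 1 := by omega
  generalize Nat.log 2 (superLen n) + 1 = s at *
  generalize superLen n = L at *
  have hβ : n / minBlockLen n * minBlockLen n ≤ n := Nat.div_mul_le_self _ _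
  have hq : Nat.sqrt n * Nat.sqrt n ≤ n := Nat.sqrt_le n
  have hq1 : 1 ≤ Nat.sqrt n := Nat.le_sqrt.mpr (by omega)
  generalize n / minBlockLen n = d at *
  generalize minBlockLen n = β at *
  generalize Nat.sqrt n = q at *
  have hd : (d + 1) / L * L ≤ d + 1 := Nat.div_mul_le_self _ _
  generalize (d + 1) / L = e at *
  -- The coefficients are chosen so that each of the three terms, multiplied by `c`, is at most `n /
  -- 3`.
  have t1 : 3 * (c * (11 * C + 18)) * L ≤ n := by simpa using h1
  have t2 : 6 * (c * C) * L ^ 2 * q ≤ n := (Nat.mul_le_mul_right q h2).trans hq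
  have t3 : d * (3 * (c * (2 * C + 9)) * s) ≤ n := (Nat.mul_le_mul_left d h3).trans hβ
  have a1 : (7 + (2 * (e + 1) + (q + 1) * L)) * w n
      ≤ 9 * C * L + 2 * C * (d + 1) + C * L ^ 2 * (2 * q) := by
    calc (7 + (2 * (e + 1) + (q + 1) * L)) * w n
        ≤ (7 + (2 * (e + 1) + (q + 1) * L)) * (C * L) := Nat.mul_le_mul_left _ hw
      _ = 9 * C * L + 2 * C * (e * L) + C * L ^ 2 * (q + 1) := by ring
      _ ≤ 9 * C * L + 2 * C * (d + 1) + C * L ^ 2 * (2 * q) := by gcongr; omega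
  have a2 : 2 * C * (d + 1) ≤ 2 * C * (d * s) + 2 * C * L := by
    have : d + 1 ≤ d * s + L := Nat.add_le_add (Nat.le_mul_of_pos_right _ hs1) hL
    nlinarith
  have a3 : (d + 2) * (3 * (3 * s)) ≤ 9 * (d * s) + 18 * L := by nlinarith
  have total : (7 + (2 * (e + 1) + (q + 1) * L)) * w n + (d + 2) * (3 * (3 * s))
      ≤ (11 * C + 18) * L + (2 * C + 9) * (d * s) + 2 * C * L ^ 2 * q := by
    nlinarith
  have := Nat.mul_le_mul_left c total
  have b1 : 3 * (c * ((11 * C + 18) * L + (2 * C + 9) * (d * s) + 2 * C * L ^ 2 * q))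
    = 3 * (c * (11 * C + 18)) * L + d * (3 * (c * (2 * C + 9)) * s) + 6 * (c * C) * L ^ 2 * q := by
    ring
  omega

/-! ### Consequences of the growth hypotheses on `Δ` and `w`. -/

theorem log_le_superLen (n : ℕ) : Real.log n ≤ superLen n := by
  rcases Nat.eq_zero_or_pos n with rfl | h0
  · simp
  have h : (n : ℝ) ≤ 2 ^ superLen n := by exact_mod_cast (lt_two_pow_superLen n).le
  calc Real.log n ≤ Real.log (2 ^ superLen n) := Real.log_le_log (by exact_mod_cast h0) h
    _ = superLen n * Real.log 2 := Real.log_pow _ _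
    _ ≤ superLen n * 1 := by
      gcongr
      linarith [Real.log_two_lt_d9]
    _ = superLen n := mul_one _

theorem tendsto_log_natCast : Tendsto (fun n : ℕ => Real.log n) atTop atTop :=
  Real.tendsto_log_atTop.comp tendsto_natCast_atTop_atTop

theorem eventually_le_superLen {Δ : ℕ → ℕ} (hΔ : (fun n : ℕ => (Δ n : ℝ)) =o[atTop]
    fun n : ℕ => Real.log n / Real.log (Real.log n) ^ 2) :
    ∀ᶠ n in atTop, Δ n ≤ superLen n := by
  filter_upwards [hΔ.bound one_pos, tendsto_log_natCast.eventually_ge_atTop 0,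
    (Real.tendsto_log_atTop.comp tendsto_log_natCast).eventually_ge_atTop 1] with n h h1 h2
  simp only [Function.comp] at h2
  rw [Real.norm_of_nonneg (by positivity), Real.norm_of_nonneg (by positivity), one_mul] at h
  have h3 : Real.log n / Real.log (Real.log n) ^ 2 ≤ Real.log n :=
    div_le_self h1 (one_le_pow₀ h2)
  exact_mod_cast h.trans (h3.trans (log_le_superLen n))

theorem exists_le_mul_superLen {w : ℕ → ℕ}
    (hw : (fun n : ℕ => (w n : ℝ)) =O[atTop] fun n : ℕ => Real.log n) :
    ∃ C : ℕ, ∀ᶠ n in atTop, w n ≤ C * superLen n := by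
  obtain ⟨c, hc⟩ := hw.bound
  refine ⟨⌈c⌉₊, ?_⟩
  filter_upwards [hc, tendsto_log_natCast.eventually_ge_atTop 0] with n h h1
  rw [Real.norm_of_nonneg (by positivity), Real.norm_of_nonneg h1] at h
  have h2 : c * Real.log n ≤ ⌈c⌉₊ * superLen n :=
    mul_le_mul (Nat.le_ceil c) (log_le_superLen n) h1 (by positivity)
  exact_mod_cast h.trans h2

/-- The hypothesis gives `n * n ^ ε ≤ 2 ^ w`, and `n ^ ε` outgrows every multiple of `log n`. -/
theorem eventually_mul_superLen_le_two_pow {w : ℕ → ℕ}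
    (hw : ∃ ε : ℝ, 0 < ε ∧ ∀ᶠ n : ℕ in atTop, (1 + ε) * Real.logb 2 n ≤ w n) (c : ℕ) :
    ∀ᶠ n : ℕ in atTop, c * (n * superLen n) ≤ 2 ^ w n := by
  obtain ⟨ε, hε, hw⟩ := hw
  have hlit := ((isLittleO_log_rpow_atTop hε).comp_tendsto tendsto_natCast_atTop_atTop).bound
    (show (0 : ℝ) < 1 / (3 * (c + 1)) by positivity)
  filter_upwards [hw, hlit, tendsto_log_natCast.eventually_ge_atTop 1, eventually_gt_atTop 0]
    with n h1 h2 h3 h0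
  have hn : (0 : ℝ) < n := by exact_mod_cast h0
  simp only [Function.comp] at h2
  rw [Real.norm_of_nonneg (by linarith), Real.norm_of_nonneg (by positivity), div_mul_eq_mul_div,
    one_mul, le_div_iff₀ (by positivity)] at h2
  -- `log₂ n ≤ 2 * log n`, and the `+ 1` in `superLen` is at most `log n` by `h3`.
  have hL : (superLen n : ℝ) ≤ 3 * Real.log n := by
    have h4 : ((Nat.log 2 n : ℕ) : ℝ) ≤ Real.logb 2 n := Real.natLog_le_logb n 2
    have h5 : Real.logb 2 n ≤ 2 * Real.log n := by
      rw [Real.logb, div_le_iff₀ (Real.log_pos (by norm_num))]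
      nlinarith [Real.log_two_gt_d9]
    rw [superLen]; push_cast; linarith
  have hpow : (n : ℝ) * (n : ℝ) ^ ε ≤ 2 ^ w n := by
    calc (n : ℝ) * (n : ℝ) ^ ε = (n : ℝ) ^ (1 + ε) := by
          rw [Real.rpow_add hn, Real.rpow_one]
      _ = (2 : ℝ) ^ ((1 + ε) * Real.logb 2 n) := by
          rw [mul_comm, Real.rpow_mul (by norm_num), Real.rpow_logb (by norm_num) (by norm_num) hn]
      _ ≤ (2 : ℝ) ^ (w n : ℝ) := Real.rpow_le_rpow_of_exponent_le (by norm_num) h1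
      _ = 2 ^ w n := Real.rpow_natCast _ _
  have hmain : (c : ℝ) * (n * superLen n) ≤ 2 ^ w n := by
    refine le_trans ?_ hpow
    have : (c : ℝ) * superLen n ≤ (n : ℝ) ^ ε := by
      refine le_trans ?_ h2
      have hc : (0 : ℝ) ≤ c := by positivity
      nlinarith
    nlinarith
  exact_mod_cast hmain

end FV

theorem lemma1 :
    ∃ (P : WordRAM.Program) (T : ℕ),
      ∀ (Δ w : ℕ → ℕ),
        ((fun n : ℕ => (Δ n : ℝ)) =o[atTop]
          fun n : ℕ => Real.log n / Real.log (Real.log n) ^ 2) →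
        ((fun n : ℕ => (w n : ℝ)) =O[atTop] fun n : ℕ => Real.log n) →
        (∃ ε : ℝ, 0 < ε ∧ ∀ᶠ n : ℕ in atTop, (1 + ε) * Real.logb 2 n ≤ w n) →
        ∃ g : ℕ → ℕ,
          ((fun n : ℕ => (g n : ℝ)) =o[atTop] fun n : ℕ => (n : ℝ)) ∧
          ∀ᶠ n : ℕ in atTop, ∀ (σ : ℕ) (S : List ℕ),
            S.length = n → σ ≤ Δ n → (∀ x ∈ S, 1 ≤ x ∧ x ≤ σ) →
            ∃ A : List Bool, A.length ≤ g n ∧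
              ∀ i ≤ n,
                WordRAM.Answers P (w n) (A ++ FV.representation σ S) i (S.take i).sum T := by
  refine ⟨sumProgram, 58, fun Δ w hΔ hwO hwε => ?_⟩
  obtain ⟨C, hC⟩ := FV.exists_le_mul_superLen hwO
  refine ⟨fun n => FV.auxBound n (w n), ?_, ?_⟩
  · rw [isLittleO_iff_nat_mul_le]
    intro c
    filter_upwards [FV.eventually_mul_auxBound_le hC c] with n hn
    rw [Real.norm_of_nonneg (by positivity), Real.norm_of_nonneg (by positivity)]
    exact_mod_cast hn
  -- In units of `n * superLen n`, the constant `13` covers `11` for the representation, `1` for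
  -- `A`, and `1` for the two spare positions, as `n ≥ 2`. The constant `9` makes a whole block
  -- record fit into a word.
  · filter_upwards [FV.eventually_mul_auxBound_le hC 1, FV.eventually_le_superLen hΔ,
      FV.eventually_mul_superLen_le_two_pow hwε 13, FV.eventually_mul_superLen_pow_le_sqrt 2 1,
      FV.eventually_mul_le_minBlockLen 1, eventually_ge_atTop 2,
      FV.tendsto_superLen.eventually (FV.eventually_mul_log_pow_le 9 1)]
      with n haux hΔ hpow hsqrt hmin hn hrel
    rintro σ S rfl hσ hS
    rw [pow_one] at hsqrt hrel
    have hL : 0 < FV.superLen S.length := Nat.succ_pos _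
    have h0 : 0 < S.length := by omega
    have hnL : S.length ≤ S.length * FV.superLen S.length := Nat.le_mul_of_pos_right _ hL
    have hLw : FV.superLen S.length ≤ w S.length := Nat.log_lt_of_lt_pow h0.ne' (by omega)
    have hA := FV.length_auxBits_le hS h0 (hσ.trans hΔ) (by omega) (by omega) (w S.length)
    refine ⟨FV.auxBits σ S (w S.length), hA, fun i hi =>
      FV.auxBits_answers hS h0 (hσ.trans hΔ) ?_ ?_ (by omega) hi⟩
    · rw [FV.relWidth]; omega
    · have := FV.length_representation_le h0 (hσ.trans hΔ)
      rw [List.length_append]; omega
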